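/- **Setting.** Let $\mathcal V$ be a finite vocabulary, $K\in\mathbb N$ a context bound, $\mathcal V^{\le K}=\bigcup_{k=1}^K\mathcal V^k$ the set of non-empty prompts of length at most $K$, $\Delta^{|\mathcal V|-1}$ the set of probability vectors on $\mathcal V$, $d\ge 4$ an embedding dimension and $L\ge 1$ a number of blocks. Consider the causal decoder-only Transformer language model built as follows. * *Layer normalization* with constant $\varepsilon>0$ and trainable $\gamma,\beta\in\mathbb R^d$: $\mathrm{LN}(x)=\gamma\odot\frac{x-\mu_x\mathbf 1}{\sqrt{\sigma_x^2+\varepsilon}}+\beta$, where $\mu_x=\frac1d\sum_i x_i$ and $\sigma_x^2=\frac1d\sum_i(x_i-\mu_x)^2$. On matrices it is applied row by row. * *Causal attention head* of dimension $d_\eta\ge1$ with trainable $Q,K,V\in\mathbb R^{d\times d_\eta}$: for $X\in\mathbb R^{n\times d}$ it returns $A\,XV$, where $A_{ij}=e^{Z_{ij}}/\sum_{k\le i}e^{Z_{ik}}$ for $j\le i$, $A_{ij}=0$ for $j>i$, and $Z=(XQ)(XK)^\top/\sqrt{d_\eta}$. *Multi-head attention* $\mathrm{attn}$ with $H\ge1$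 heads concatenates the outputs of $H$ heads (each with its own parameters) horizontally and multiplies on the right by a trainable $W^O\in\mathbb R^{Hd_\eta\times d}$. * *MLP* with $M\ge1$ layers and activation $\sigma:\mathbb R\to\mathbb R$: $h^{(1)}=W^{(1)}x+b^{(1)}$, $h^{(m)}=W^{(m)}\sigma(h^{(m-1)})+b^{(m)}$ for $2\le m\le M$, $\mathrm{mlp}(x)=h^{(M)}$, with trainable $W^{(m)},b^{(m)}$, arbitrary hidden widths, input and output width $d$, and $\sigma$ acting coordinatewise. * *Block*: $X\mapsto Y+\mathrm{mlp}(\mathrm{LN}_2(Y))$, where $Y=X+\mathrm{attn}(\mathrm{LN}_1(X))$; the MLP acts row by row and $\mathrm{LN}_1,\mathrm{LN}_2$ have separate parameters. The $L$ blocks have separate parameters, and $H$, $d_\eta$, $M$, the hidden widths, the activation and the constants $\varepsilon$ may depend on the block; every activation is real-analytic on $\mathbb R$, and every layer-normalization constant (including the one in the unembedding) is positive. With trainable token embeddings $E\in\mathbb R^{|\mathcal V|\times d}$ and positional embeddings $P\in\mathbb R^{K\times d}$, a prompt $s=\langle s_1,\dots,s_n\rangle$ is embedded as the matrix with rows $E_{s_i}+P_i$.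 The blocks are applied in order, and the last row of the result is the last-token representation $\mathbf r(s;\theta)\in\mathbb R^d$. The next-token distribution is $f(s;\theta)=\mathrm{softmax}\big(U\,\mathrm{LN}(\mathbf r(s;\theta))\big)$, with trainable $U\in\mathbb R^{|\mathcal V|\times d}$ and a final layer normalization with its own trainable parameters. Here $\theta\in\mathbb R^p$ collects all trainable parameters. **Training.** Let $T\in\mathbb N$, let $(s_t,\mathbf p_t)\in\mathcal V^{\le K}\times\Delta^{|\mathcal V|-1}$ and $\eta_t\in(0,1)$, for $0\le t<T$, be arbitrary sequences of samples and step sizes, and put $\mathcal L_{s,\mathbf p}(\theta)=-\sum_{v\in\mathcal V}\mathbf p_v\log f(s;\theta)_v$. Let $\mu$ be a probability measure on $\mathbb R^p$ that is absolutely continuous with respect to Lebesgue measure, and let $$\theta_0\sim\mu,\qquad \theta_{t+1}=\theta_t-\eta_t\nabla\mathcal L_{s_t,\mathbf p_t}(\theta_t)\qquad(0\le t<T).$$ **Theorem.** With probability one over the draw of $\theta_0$, the map $\mathcal V^{\le K}\ni s\mapsto\mathbf r(s;\theta_T)\in\mathbb R^d$ is injective. Equivalently, $$\Pr\big[\exists\,s\ne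 s'\in\mathcal V^{\le K}:\ \mathbf r(s;\theta_T)=\mathbf r(s';\theta_T)\big]=0 .$$ -/

import Mathlib

open MeasureTheory

noncomputable section

namespace TransformerLM

/-! ### Elementary maps -/

/-- Softmax of a vector of logits. -/
def softmax {ι : Type*} [Fintype ι] (z : ι → ℝ) : ι → ℝ :=
  fun i => Real.exp (z i) / ∑ j, Real.exp (z j)

/-- Cross-entropy of the predicted distribution `q` against the target distribution `p`. -/
def crossEntropy {ι : Type*} [Fintype ι] (q p : ι → ℝ) : ℝ :=
  -∑ i, p i * Real.log (q i)

/-- Mean of the coordinates of a vector. -/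
def mean {d : ℕ} (x : Fin d → ℝ) : ℝ := (∑ i, x i) / d

/-- (Biased) variance of the coordinates of a vector. -/
def variance {d : ℕ} (x : Fin d → ℝ) : ℝ := (∑ i, (x i - mean x) ^ 2) / d

/-- Layer normalization with scale `γ`, shift `β` and constant `ε`. -/
def layerNorm {d : ℕ} (ε : ℝ) (γ β : Fin d → ℝ) (x : Fin d → ℝ) : Fin d → ℝ :=
  fun i => γ i * ((x i - mean x) / Real.sqrt (variance x + ε)) + β i

/-- Layer normalization applied to each row of a matrix. -/
def layerNormRows {n d : ℕ} (ε : ℝ) (γ β : Fin d → ℝ) (X : Matrix (Fin n) (Fin d) ℝ) :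
    Matrix (Fin n) (Fin d) ℝ :=
  Matrix.of fun i => layerNorm ε γ β (X i)

/-! ### Causal self-attention -/

/-- Divide each row of a matrix by its sum. -/
def rowNormalize {n : ℕ} (A : Matrix (Fin n) (Fin n) ℝ) : Matrix (Fin n) (Fin n) ℝ :=
  Matrix.of fun i j => A i j / ∑ k, A i k

/-- The unit lower-triangular matrix, with entry `1` where `j ≤ i` and `0` elsewhere. -/
def causalMask (n : ℕ) : Matrix (Fin n) (Fin n) ℝ :=
  Matrix.of fun i j => if j ≤ i then 1 else 0

/-- One causal self-attention head: row-normalized `causalMask ⊙ exp ((XQ)(XK)ᵀ / √a)`,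
times `XV`, where `a` is the attention dimension. -/
def causalAttention {n d a : ℕ} (Q K V : Matrix (Fin d) (Fin a) ℝ)
    (X : Matrix (Fin n) (Fin d) ℝ) : Matrix (Fin n) (Fin a) ℝ :=
  rowNormalize (Matrix.hadamard (causalMask n)
    (((Real.sqrt a)⁻¹ • ((X * Q) * (X * K).transpose)).map Real.exp)) * (X * V)

/-- Multi-head causal self-attention with `H` heads. The columns of the concatenation of the
head outputs, and the rows of the output projection `O`, are indexed by pairs
(head, coordinate in that head). -/
def multiHead {n d H a : ℕ} (Q K V : Fin H → Matrix (Fin d) (Fin a) ℝ)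
    (O : Matrix (Fin H × Fin a) (Fin d) ℝ) (X : Matrix (Fin n) (Fin d) ℝ) :
    Matrix (Fin n) (Fin d) ℝ :=
  (Matrix.of fun i (k : Fin H × Fin a) => causalAttention (Q k.1) (K k.1) (V k.1) X i k.2) * O

/-! ### Multi-layer perceptron -/

/-- Index set of the scalar parameters of an MLP with input width `a`, output width `b` and
list of hidden widths `l` (so with `l.length + 1` layers): for each layer, the entries of its
weight matrix (output row, input column) and of its bias vector. -/
def MlpParam : ℕ → List ℕ → ℕ → Type
  | a, [], b => (Fin b × Fin a) ⊕ Fin b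
  | a, c :: l, b => ((Fin c × Fin a) ⊕ Fin c) ⊕ MlpParam c l b

instance instFintypeMlpParam : (a : ℕ) → (l : List ℕ) → (b : ℕ) → Fintype (MlpParam a l b)
  | a, [], b => inferInstanceAs (Fintype ((Fin b × Fin a) ⊕ Fin b))
  | a, c :: l, b =>
    letI := instFintypeMlpParam c l b
    inferInstanceAs (Fintype (((Fin c × Fin a) ⊕ Fin c) ⊕ MlpParam c l b))

/-- The affine map `x ↦ W x + b`, its parameters given as one family. -/
def affine {a b : ℕ} (P : (Fin b × Fin a) ⊕ Fin b → ℝ) (x : Fin a → ℝ) : Fin b → ℝ :=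
  fun i => (∑ j, P (Sum.inl (i, j)) * x j) + P (Sum.inr i)

/-- The MLP: affine layers, with the activation `σ` applied coordinatewise between two
consecutive layers (and not after the last one). -/
def mlp (σ : ℝ → ℝ) :
    (a : ℕ) → (l : List ℕ) → (b : ℕ) → (MlpParam a l b → ℝ) → (Fin a → ℝ) → (Fin b → ℝ)
  | _, [], _, P, x => affine P x
  | _, c :: l, b, P, x =>
    mlp σ c l b (fun k => P (Sum.inr k)) (fun i => σ (affine (fun k => P (Sum.inl k)) x i))

/-! ### The architecture and its parameters -/

/-- Hyperparameters of a transformer block: number of heads, attention dimension, hidden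
widths of the MLP, activation of the MLP, and the constants of the two layer normalizations. -/
structure BlockConfig where
  heads : ℕ
  attnDim : ℕ
  hidden : List ℕ
  act : ℝ → ℝ
  epsAttn : ℝ
  epsMlp : ℝ

/-- Hyperparameters of a transformer language model: context bound `K`, embedding dimension `d`,
number `L` of blocks, the blocks, and the constant of the layer normalization in the
unembedding layer. -/
structure Config where
  K : ℕ
  d : ℕ
  L : ℕ
  block : Fin L → BlockConfig
  epsOut : ℝ

/-- Index set of the scalar parameters of a block of width `d`. -/
inductive BlockParam (d : ℕ) (c : BlockConfig) : Type
  | query (h : Fin c.heads) (i : Fin d) (j : Fin c.attnDim)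
  | key (h : Fin c.heads) (i : Fin d) (j : Fin c.attnDim)
  | value (h : Fin c.heads) (i : Fin d) (j : Fin c.attnDim)
  | out (k : Fin c.heads × Fin c.attnDim) (i : Fin d)
  | scaleAttn (i : Fin d)
  | shiftAttn (i : Fin d)
  | scaleMlp (i : Fin d)
  | shiftMlp (i : Fin d)
  | mlp (k : MlpParam d c.hidden d)
  deriving Fintype

/-- Index set of all the scalar parameters of the model over the vocabulary `V`. -/
inductive Param (V : Type*) (c : Config)
  | token (v : V) (i : Fin c.d)
  | position (j : Fin c.K) (i : Fin c.d)
  | block (l : Fin c.L) (k : BlockParam c.d (c.block l))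
  | unembed (v : V) (i : Fin c.d)
  | scaleOut (i : Fin c.d)
  | shiftOut (i : Fin c.d)
  deriving Fintype

/-- The parameter space `ℝ^p`, with the Euclidean inner product and Lebesgue measure. -/
abbrev Params (V : Type*) (c : Config) : Type _ := EuclideanSpace ℝ (Param V c)

/-- The prompts: sequences of tokens of length between `1` and `K`. The pair `⟨m, s⟩` stands
for the sequence `s` of length `m + 1`. -/
abbrev Prompt (V : Type*) (K : ℕ) : Type _ := Σ m : Fin K, (Fin (m.val + 1) → V)

/-! ### The model -/

/-- A (pre-normalization, residual) transformer block. -/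
def blockMap {n d : ℕ} (c : BlockConfig) (P : BlockParam d c → ℝ)
    (X : Matrix (Fin n) (Fin d) ℝ) : Matrix (Fin n) (Fin d) ℝ :=
  let Y : Matrix (Fin n) (Fin d) ℝ := X + multiHead
    (fun h => Matrix.of fun i j => P (.query h i j))
    (fun h => Matrix.of fun i j => P (.key h i j))
    (fun h => Matrix.of fun i j => P (.value h i j))
    (Matrix.of fun k i => P (.out k i))
    (layerNormRows c.epsAttn (fun i => P (.scaleAttn i)) (fun i => P (.shiftAttn i)) X)
  let Z : Matrix (Fin n) (Fin d) ℝ :=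
    layerNormRows c.epsMlp (fun i => P (.scaleMlp i)) (fun i => P (.shiftMlp i)) Y
  Y + Matrix.of fun i => mlp c.act d c.hidden d (fun k => P (.mlp k)) (Z i)

variable {V : Type*}

/-- Token plus (learned, absolute) positional embedding of a prompt. -/
def embed (c : Config) (θ : Params V c) (s : Prompt V c.K) :
    Matrix (Fin (s.1.val + 1)) (Fin c.d) ℝ :=
  Matrix.of fun j i => θ (.token (s.2 j) i) + θ (.position (Fin.castLE s.1.isLt j) i)

/-- The composition of the `L` blocks, the block of index `0` being applied first. -/
def stack (c : Config) (θ : Params V c) {n : ℕ} (X : Matrix (Fin n) (Fin c.d) ℝ) :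
    Matrix (Fin n) (Fin c.d) ℝ :=
  Fin.foldl c.L (fun Y l => blockMap (c.block l) (fun k => θ (.block l k)) Y) X

/-- The last-token, last-layer representation of a prompt. -/
def lastRep (c : Config) (θ : Params V c) (s : Prompt V c.K) : EuclideanSpace ℝ (Fin c.d) :=
  WithLp.toLp 2 (stack c θ (embed c θ s) (Fin.last s.1.val))

variable [Fintype V]

/-- The next-token distribution: softmax of the unembedding of the normalized representation. -/
def predict (c : Config) (θ : Params V c) (s : Prompt V c.K) : V → ℝ :=
  softmax fun v => ∑ i, θ (.unembed v i) *
    layerNorm c.epsOut (fun k => θ (.scaleOut k)) (fun k => θ (.shiftOut k)) (lastRep c θ s) i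

/-- The cross-entropy loss of the model at the sample `(s, p)`. -/
def loss (c : Config) (s : Prompt V c.K) (p : V → ℝ) (θ : Params V c) : ℝ :=
  crossEntropy (predict c θ s) p

/-- One step of gradient descent with step size `η` on the sample `(s, p)`. -/
def gdStep (c : Config) (η : ℝ) (s : Prompt V c.K) (p : V → ℝ) (θ : Params V c) : Params V c :=
  θ - η • gradient (loss c s p) θ

end TransformerLM

end

/-! ### Analytic functions and null sets -/

open scoped Topology

/-! Everything is real-analytic in the parameters, so both the representation map and the gradient
step need only be examined at well-chosen parameters.

For two fixed distinct prompts, the set of parameters where their representations agree lies in the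
zero set of an analytic function, one coordinate of the difference. This set is null once a single
parameter separates the prompts (`exists_lastRep_ne`), and there are only finitely many pairs.

Training preserves this because gradient steps pull null sets back to null sets
(`volume_preimage_gdStep`). The Jacobian determinant of a step is analytic, so it vanishes almost
nowhere if it is nonzero at one point; off its zero set the step is a local diffeomorphism. The
point used is the zero parameter. Along any line through it the logits are `t ^ 2` times an analytic
function, since the unembedding matrix and the last normalization both scale with `t`. Hence the
Hessian `H` of the loss there sees only the unembedding matrix and the output shift, and
Cauchy-Schwarz gives `H ≤ I` (`deriv_deriv_loss_zero_le`). As `η < 1`, the Jacobian `I - η H` is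
injective. Induction on the steps then shows that the trained parameter almost surely avoids each
null set. -/

theorem AnalyticOnNhd.ae_ne_zero_of_real {h : ℝ → ℝ} (hh : AnalyticOnNhd ℝ h Set.univ)
    {a : ℝ} (ha : h a ≠ 0) : ∀ᵐ t, h t ≠ 0 := by
  have h1 : {t | h t ≠ 0} ∈ Filter.codiscreteWithin (Set.univ : Set ℝ) := by
    rcases hh.eqOn_zero_or_eventually_ne_zero_of_preconnected isPreconnected_univ with h0 | h0
    · exact absurd (h0 (Set.mem_univ a)) ha
    · exact h0
  have h2 := ae_restrict_le_codiscreteWithin (μ := volume) MeasurableSet.univ h1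
  rwa [Measure.restrict_univ] at h2

section FiniteDimensional

variable {E : Type*} [NormedAddCommGroup E] [NormedSpace ℝ E] [MeasurableSpace E] [BorelSpace E]
  [FiniteDimensional ℝ E] (μ : Measure E) [μ.IsAddHaarMeasure]

/-- The zero set of a real-analytic function that does not vanish identically is null. -/
theorem AnalyticOnNhd.ae_ne_zero {f : E → ℝ} (hf : AnalyticOnNhd ℝ f Set.univ)
    {x₀ : E} (hx₀ : f x₀ ≠ 0) : ∀ᵐ x ∂μ, f x ≠ 0 := by
  have hcont : Continuous f := continuousOn_univ.1 hf.continuousOn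
  -- Restrict to lines through `x₀`: each restriction is nonzero at `t = 0`, so the one-variable
  -- case applies.
  have h1 : ∀ x : E, ∀ᵐ t : ℝ, f (x₀ + t • x) ≠ 0 := by
    intro x
    refine AnalyticOnNhd.ae_ne_zero_of_real (h := fun t => f (x₀ + t • x)) ?_ (a := 0) (by simpa)
    intro t _
    exact (hf _ (Set.mem_univ _)).comp (f := fun t : ℝ => x₀ + t • x)
      (analyticAt_const.add (analyticAt_id.smul analyticAt_const))
  have hmeas : MeasurableSet {q : E × ℝ | f (x₀ + q.2 • q.1) ≠ 0} :=
    (isOpen_ne_fun (f := fun q : E × ℝ => f (x₀ + q.2 • q.1)) (by fun_prop)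
      continuous_const).measurableSet
  have h2 : ∀ᵐ t : ℝ, ∀ᵐ x ∂μ, f (x₀ + t • x) ≠ 0 :=
    (Measure.ae_ae_comm (μ := μ) (ν := volume) (p := fun x t => f (x₀ + t • x) ≠ 0) hmeas).1
      (Filter.Eventually.of_forall h1)
  -- By Fubini one nonzero `t` works for almost every `x`; then `x ↦ x₀ + t • x` is an invertible
  -- affine map and carries the statement over to `f`.
  obtain ⟨t, ht, ht0⟩ := (h2.and (Measure.ae_ne volume (0 : ℝ))).exists
  rw [ae_iff] at ht ⊢
  have h3 : {x | ¬ f (x₀ + t • x) ≠ 0} =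
      (fun x => t • x) ⁻¹' ((fun x => x₀ + x) ⁻¹' {x | ¬ f x ≠ 0}) := rfl
  rw [h3, Measure.addHaar_preimage_smul μ ht0, measure_preimage_add] at ht
  refine (mul_eq_zero.1 ht).resolve_left ?_
  simp [ht0]

/-- A null set has null preimage in the region where the derivative is invertible. -/
theorem measure_preimage_inter_det_fderiv_ne_zero {f : E → E} (hf : ContDiff ℝ 1 f) {N : Set E}
    (hN : μ N = 0) : μ (f ⁻¹' N ∩ {x | (fderiv ℝ f x).det ≠ 0}) = 0 := by
  refine measure_null_of_locally_null _ fun x hx => ?_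
  have hdet : Continuous fun y => (fderiv ℝ f y).det :=
    ContinuousLinearMap.continuous_det.comp (hf.continuous_fderiv one_ne_zero)
  have hs : HasStrictFDerivAt f (fderiv ℝ f x) x :=
    hf.contDiffAt.hasStrictFDerivAt one_ne_zero
  let e : E ≃L[ℝ] E := (fderiv ℝ f x).toContinuousLinearEquivOfDetNeZero hx.2
  have he : HasStrictFDerivAt f (e : E →L[ℝ] E) x := by
    simpa [e] using hs
  let φ := he.toOpenPartialHomeomorph f
  have hinj : Set.InjOn f φ.source := φ.injOn
  have hxs : φ.source ∈ 𝓝 x := φ.open_source.mem_nhds he.mem_toOpenPartialHomeomorph_source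
  -- `N` need not be measurable, but the change of variables formula needs a measurable domain.
  obtain ⟨N', hNN', hN'm, hN'⟩ := exists_measurable_superset_of_null hN
  let A : Set E := (f ⁻¹' N' ∩ {x | (fderiv ℝ f x).det ≠ 0}) ∩ φ.source
  have hA : MeasurableSet A :=
    ((hf.continuous.measurable hN'm).inter
      (isOpen_ne_fun hdet continuous_const).measurableSet).inter φ.open_source.measurableSet
  refine ⟨A, ?_, ?_⟩
  · filter_upwards [self_mem_nhdsWithin, nhdsWithin_le_nhds hxs] with y hy hys
    exact ⟨⟨hNN' hy.1, hy.2⟩, hys⟩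
  -- The integral of `|det|` over `A` equals the measure of `f '' A ⊆ N'`, which is zero; as the
  -- determinant has no zero on `A`, the set `A` is null.
  · have hint := lintegral_abs_det_fderiv_eq_addHaar_image μ hA
      (fun y _ => ((hf.differentiable one_ne_zero y).hasFDerivAt).hasFDerivWithinAt)
      (hinj.mono Set.inter_subset_right)
    have himg : μ (f '' A) = 0 :=
      measure_mono_null (by rintro _ ⟨y, hy, rfl⟩; exact hy.1.1) hN'
    rw [himg, lintegral_eq_zero_iff hdet.abs.measurable.ennreal_ofReal, Filter.EventuallyEq,
      ae_restrict_iff' hA, ae_iff] at hint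
    refine measure_mono_null (fun y hy => ?_) hint
    simpa using ⟨hy, hy.1.2⟩

/-- A real-analytic self-map whose derivative is injective at some point pulls null sets back to
null sets. -/
theorem AnalyticOnNhd.measure_preimage_eq_zero {f : E → E} (hf : AnalyticOnNhd ℝ f Set.univ)
    {x₀ : E} (hx₀ : ∀ v, fderiv ℝ f x₀ v = 0 → v = 0) {N : Set E} (hN : μ N = 0) :
    μ (f ⁻¹' N) = 0 := by
  have hdet : AnalyticOnNhd ℝ (fun x => (fderiv ℝ f x).det) Set.univ := by
    -- The Leibniz expansion in a basis exhibits the determinant as a polynomial in analytic matrix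
    -- entries.
    let b := Module.finBasis ℝ E
    have heq : (fun x => (fderiv ℝ f x).det) =
        fun x => ∑ σ : Equiv.Perm (Fin (Module.finrank ℝ E)), ((Equiv.Perm.sign σ : ℤ) : ℝ) *
          ∏ i, b.coord (σ i) (fderiv ℝ f x (b i)) := by
      ext x
      rw [ContinuousLinearMap.det, ← LinearMap.det_toMatrix b, Matrix.det_apply']
      simp [LinearMap.toMatrix_apply]
    rw [heq]
    intro x _
    refine Finset.analyticAt_fun_sum _ fun σ _ => analyticAt_const.mul ?_
    refine Finset.analyticAt_fun_prod _ fun i _ => ?_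
    have h1 : AnalyticAt ℝ (fun x => fderiv ℝ f x (b i)) x :=
      ((ContinuousLinearMap.apply ℝ E (b i)).analyticAt _).comp (hf x (Set.mem_univ x)).fderiv
    exact ((b.coord (σ i)).toContinuousLinearMap.analyticAt _).comp h1
  have hne : (fderiv ℝ f x₀).det ≠ 0 := by
    intro h0
    obtain ⟨v, hv, hv0⟩ := SetLike.exists_of_lt
      (bot_lt_iff_ne_bot.2 (mt LinearMap.ker_eq_bot.1 fun hinj =>
        (LinearMap.isUnit_iff_isUnit_det (fderiv ℝ f x₀ : E →ₗ[ℝ] E)).1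
          ((LinearMap.isUnit_iff_ker_eq_bot _).2 (LinearMap.ker_eq_bot.2 hinj)) |>.ne_zero h0))
    exact hv0 ((Submodule.mem_bot ℝ).2 (hx₀ v hv))
  have hae := hdet.ae_ne_zero μ hne
  rw [ae_iff] at hae
  have hC : ContDiff ℝ 1 f := contDiff_iff_contDiffAt.2 fun x =>
    (hf x (Set.mem_univ x)).contDiffAt
  refine measure_mono_null (t := (f ⁻¹' N ∩ {x | (fderiv ℝ f x).det ≠ 0}) ∪
    {x | ¬ (fderiv ℝ f x).det ≠ 0}) (fun x hx => ?_)
    (measure_union_null (measure_preimage_inter_det_fderiv_ne_zero μ hC hN) hae)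
  by_cases h : (fderiv ℝ f x).det ≠ 0
  · exact Or.inl ⟨hx, h⟩
  · exact Or.inr h

end FiniteDimensional

/-! ### Injectivity of the derivative of a gradient step -/

section GradientDescent

variable {E : Type*} [NormedAddCommGroup E] [InnerProductSpace ℝ E] [CompleteSpace E]

theorem AnalyticOnNhd.gradient {L : E → ℝ} (hL : AnalyticOnNhd ℝ L Set.univ) :
    AnalyticOnNhd ℝ (gradient L) Set.univ := fun x _ =>
  ((InnerProductSpace.toDual ℝ E).symm.toContinuousLinearEquiv.toContinuousLinearMap.analyticAt
    _).comp (hL x (Set.mem_univ x)).fderiv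

/-- If the second derivative of `L` along every line through `x` is at most the squared length of
the direction, a gradient step of size `η < 1` has injective derivative at `x`. -/
theorem fderiv_sub_smul_gradient_injective {L : E → ℝ} (hL : AnalyticOnNhd ℝ L Set.univ) {η : ℝ}
    (hη : η ∈ Set.Ioo (0 : ℝ) 1) {x : E}
    (hbound : ∀ v : E, deriv (deriv fun t : ℝ => L (x + t • v)) 0 ≤ ‖v‖ ^ 2)
    {v : E} (hv : fderiv ℝ (fun y => y - η • _root_.gradient L y) x v = 0) : v = 0 := by
  have hdiff : ∀ y, DifferentiableAt ℝ L y := fun y => (hL y (Set.mem_univ y)).differentiableAt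
  have hline : ∀ t : ℝ, HasDerivAt (fun t : ℝ => x + t • v) v t := fun t => by
    simpa using ((hasDerivAt_id t).smul_const v).const_add x
  have hd : deriv (fun t : ℝ => L (x + t • v)) =
      fun t => inner ℝ (_root_.gradient L (x + t • v)) v := by
    ext t
    refine ((hdiff _).hasFDerivAt.comp_hasDerivAt t (hline t)).deriv.trans ?_
    simp [_root_.gradient]
  have hg : DifferentiableAt ℝ (_root_.gradient L) x :=
    (hL.gradient x (Set.mem_univ x)).differentiableAt
  have hg' : HasFDerivAt (_root_.gradient L) (fderiv ℝ (_root_.gradient L) x)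
      (x + (0 : ℝ) • v) := by simpa using hg.hasFDerivAt
  have hdd : deriv (deriv fun t : ℝ => L (x + t • v)) 0 =
      inner ℝ (fderiv ℝ (_root_.gradient L) x v) v := by
    rw [hd]
    have := (hg'.comp_hasDerivAt (0 : ℝ) (hline 0)).inner ℝ (hasDerivAt_const (0 : ℝ) v)
    simpa using this.deriv
  have hstep : fderiv ℝ (fun y => y - η • _root_.gradient L y) x v =
      v - η • fderiv ℝ (_root_.gradient L) x v := by
    have := ((hasFDerivAt_id x).sub (hg.hasFDerivAt.const_smul η)).fderiv
    have h2 : fderiv ℝ (fun y => y - η • _root_.gradient L y) x = _ := this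
    rw [h2]; simp
  rw [hstep, sub_eq_zero] at hv
  -- A kernel vector satisfies `v = η • H v`; pairing with `v` and using the bound on `H` gives `‖v‖
  -- ^ 2 ≤ η * ‖v‖ ^ 2` with `η < 1`.
  have hsq : ‖v‖ ^ 2 = η * inner ℝ (fderiv ℝ (_root_.gradient L) x v) v := by
    rw [← real_inner_self_eq_norm_sq]
    nth_rewrite 1 [hv]
    rw [real_inner_smul_left]
  have hb := hbound v
  rw [hdd] at hb
  have : ‖v‖ ^ 2 ≤ η * ‖v‖ ^ 2 := hsq.le.trans (mul_le_mul_of_nonneg_left hb hη.1.le)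
  have h0 : ‖v‖ ^ 2 = 0 := by nlinarith [sq_nonneg ‖v‖, hη.2]
  simpa using h0

end GradientDescent

/-! ### Analyticity of the model and of the loss -/

namespace TransformerLM

section Analyticity

variable {E : Type*} [NormedAddCommGroup E] [NormedSpace ℝ E] {e : E}

theorem _root_.AnalyticAt.sqrt {f : E → ℝ} (hf : AnalyticAt ℝ f e) (h0 : 0 < f e) :
    AnalyticAt ℝ (fun x => Real.sqrt (f x)) e :=
  ((Real.contDiffAt_sqrt (n := ⊤) h0.ne').analyticAt).comp hf

theorem _root_.AnalyticAt.comp_log {f : E → ℝ} (hf : AnalyticAt ℝ f e) (h0 : 0 < f e) :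
    AnalyticAt ℝ (fun x => Real.log (f x)) e :=
  (analyticAt_log h0).comp hf

theorem variance_nonneg {d : ℕ} (x : Fin d → ℝ) : 0 ≤ variance x :=
  div_nonneg (Finset.sum_nonneg fun _ _ => sq_nonneg _) (Nat.cast_nonneg d)

theorem analyticAt_mean {d : ℕ} {x : E → Fin d → ℝ}
    (hx : ∀ i, AnalyticAt ℝ (fun a => x a i) e) : AnalyticAt ℝ (fun a => mean (x a)) e :=
  (Finset.analyticAt_fun_sum _ fun i _ => hx i).div_const

theorem analyticAt_variance {d : ℕ} {x : E → Fin d → ℝ}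
    (hx : ∀ i, AnalyticAt ℝ (fun a => x a i) e) : AnalyticAt ℝ (fun a => variance (x a)) e :=
  (Finset.analyticAt_fun_sum _ fun i _ => ((hx i).sub (analyticAt_mean hx)).pow 2).div_const

theorem analyticAt_layerNorm {d : ℕ} {ε : ℝ} (hε : 0 < ε) {γ β x : E → Fin d → ℝ}
    (hγ : ∀ i, AnalyticAt ℝ (fun a => γ a i) e) (hβ : ∀ i, AnalyticAt ℝ (fun a => β a i) e)
    (hx : ∀ i, AnalyticAt ℝ (fun a => x a i) e) (i : Fin d) :
    AnalyticAt ℝ (fun a => layerNorm ε (γ a) (β a) (x a) i) e := by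
  have hpos : 0 < variance (x e) + ε := add_pos_of_nonneg_of_pos (variance_nonneg _) hε
  exact ((hγ i).mul (((hx i).sub (analyticAt_mean hx)).div
    (((analyticAt_variance hx).add analyticAt_const).sqrt hpos)
    (Real.sqrt_pos.2 hpos).ne')).add (hβ i)

theorem analyticAt_mul_apply {ι κ τ : Type*} [Fintype κ] {A : E → Matrix ι κ ℝ}
    {B : E → Matrix κ τ ℝ} (hA : ∀ i j, AnalyticAt ℝ (fun a => A a i j) e)
    (hB : ∀ i j, AnalyticAt ℝ (fun a => B a i j) e) (i : ι) (j : τ) :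
    AnalyticAt ℝ (fun a => (A a * B a) i j) e := by
  simp only [Matrix.mul_apply]
  exact Finset.analyticAt_fun_sum _ fun k _ => (hA i k).mul (hB k j)

/-- The mask keeps the diagonal, so every row has a positive term. This keeps the attention
denominators away from zero. -/
theorem sum_causalMask_mul_exp_pos {n : ℕ} (Z : Matrix (Fin n) (Fin n) ℝ) (i : Fin n) :
    0 < ∑ k, causalMask n i k * Real.exp (Z i k) := by
  refine Finset.sum_pos' (fun k _ => mul_nonneg ?_ (Real.exp_pos _).le)
    ⟨i, Finset.mem_univ i, ?_⟩
  · simp only [causalMask, Matrix.of_apply]; split_ifs <;> norm_num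
  · simp [causalMask, Real.exp_pos]

theorem analyticAt_causalAttention {n d a : ℕ} {Q K W : E → Matrix (Fin d) (Fin a) ℝ}
    {X : E → Matrix (Fin n) (Fin d) ℝ} (hQ : ∀ i j, AnalyticAt ℝ (fun x => Q x i j) e)
    (hK : ∀ i j, AnalyticAt ℝ (fun x => K x i j) e)
    (hW : ∀ i j, AnalyticAt ℝ (fun x => W x i j) e)
    (hX : ∀ i j, AnalyticAt ℝ (fun x => X x i j) e) (i : Fin n) (j : Fin a) :
    AnalyticAt ℝ (fun x => causalAttention (Q x) (K x) (W x) (X x) i j) e := by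
  have hZ : ∀ i j, AnalyticAt ℝ (fun x =>
      ((Real.sqrt a)⁻¹ • ((X x * Q x) * (X x * K x).transpose)) i j) e := fun i j =>
    analyticAt_const.mul (analyticAt_mul_apply (analyticAt_mul_apply hX hQ)
      (B := fun x => (X x * K x).transpose) (fun i j => analyticAt_mul_apply hX hK j i) i j)
  have hE : ∀ i j, AnalyticAt ℝ (fun x => causalMask n i j *
      Real.exp (((Real.sqrt a)⁻¹ • ((X x * Q x) * (X x * K x).transpose)) i j)) e :=
    fun i j => analyticAt_const.mul (hZ i j).rexp'
  exact analyticAt_mul_apply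
    (fun i j => (hE i j).div (Finset.analyticAt_fun_sum _ fun k _ => hE i k)
      (sum_causalMask_mul_exp_pos _ i).ne') (analyticAt_mul_apply hX hW) i j

theorem analyticAt_affine {a b : ℕ} {P : E → (Fin b × Fin a) ⊕ Fin b → ℝ} {x : E → Fin a → ℝ}
    (hP : ∀ k, AnalyticAt ℝ (fun y => P y k) e) (hx : ∀ i, AnalyticAt ℝ (fun y => x y i) e)
    (i : Fin b) : AnalyticAt ℝ (fun y => affine (P y) (x y) i) e :=
  (Finset.analyticAt_fun_sum _ fun j _ => (hP _).mul (hx j)).add (hP _)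

theorem analyticAt_mlp {σ : ℝ → ℝ} (hσ : ∀ x, AnalyticAt ℝ σ x) (l : List ℕ) :
    ∀ {a b : ℕ} {P : E → MlpParam a l b → ℝ} {x : E → Fin a → ℝ},
      (∀ k, AnalyticAt ℝ (fun y => P y k) e) → (∀ i, AnalyticAt ℝ (fun y => x y i) e) →
      ∀ i : Fin b, AnalyticAt ℝ (fun y => mlp σ a l b (P y) (x y) i) e := by
  induction l with
  | nil => intro a b P x hP hx i; exact analyticAt_affine hP hx i
  | cons c l ih =>
    intro a b P x hP hx i
    exact ih (P := fun y k => P y (Sum.inr k)) (fun k => hP (Sum.inr k))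
      (fun j => (hσ _).comp (analyticAt_affine (P := fun y k => P y (Sum.inl k))
        (fun k => hP (Sum.inl k)) hx j)) i

theorem analyticAt_add_multiHead {n d H a : ℕ} {Q K W : E → Fin H → Matrix (Fin d) (Fin a) ℝ}
    {O : E → Matrix (Fin H × Fin a) (Fin d) ℝ} {N X : E → Matrix (Fin n) (Fin d) ℝ}
    (hQ : ∀ h i j, AnalyticAt ℝ (fun x => Q x h i j) e)
    (hK : ∀ h i j, AnalyticAt ℝ (fun x => K x h i j) e)
    (hW : ∀ h i j, AnalyticAt ℝ (fun x => W x h i j) e)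
    (hO : ∀ k j, AnalyticAt ℝ (fun x => O x k j) e)
    (hN : ∀ i j, AnalyticAt ℝ (fun x => N x i j) e)
    (hX : ∀ i j, AnalyticAt ℝ (fun x => X x i j) e) (i : Fin n) (j : Fin d) :
    AnalyticAt ℝ (fun x => (X x + multiHead (Q x) (K x) (W x) (O x) (N x)) i j) e :=
  (hX i j).add (analyticAt_mul_apply
    (A := fun x => Matrix.of fun i (k : Fin H × Fin a) =>
      causalAttention (Q x k.1) (K x k.1) (W x k.1) (N x) i k.2)
    (fun i k => analyticAt_causalAttention (hQ k.1) (hK k.1) (hW k.1) hN i k.2) hO i j)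

theorem analyticAt_blockMap {n d : ℕ} {c : BlockConfig} (hσ : ∀ x, AnalyticAt ℝ c.act x)
    (h1 : 0 < c.epsAttn) (h2 : 0 < c.epsMlp) {P : E → BlockParam d c → ℝ}
    {X : E → Matrix (Fin n) (Fin d) ℝ} (hP : ∀ k, AnalyticAt ℝ (fun y => P y k) e)
    (hX : ∀ i j, AnalyticAt ℝ (fun y => X y i j) e) (i : Fin n) (j : Fin d) :
    AnalyticAt ℝ (fun y => blockMap c (P y) (X y) i j) e := by
  have hY := analyticAt_add_multiHead (Q := fun y h => Matrix.of fun i j => P y (.query h i j))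
    (K := fun y h => Matrix.of fun i j => P y (.key h i j))
    (W := fun y h => Matrix.of fun i j => P y (.value h i j))
    (O := fun y => Matrix.of fun k i => P y (.out k i))
    (N := fun y => layerNormRows c.epsAttn (fun i => P y (.scaleAttn i))
      (fun i => P y (.shiftAttn i)) (X y))
    (fun _ _ _ => hP _) (fun _ _ _ => hP _) (fun _ _ _ => hP _) (fun _ _ => hP _)
    (fun i j => analyticAt_layerNorm h1 (fun _ => hP _) (fun _ => hP _) (hX i) j) hX
  have hZ := fun i => analyticAt_layerNorm h2 (fun i => hP (.scaleMlp i))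
    (fun i => hP (.shiftMlp i)) (hY i)
  have hM := analyticAt_mlp hσ _ (fun k => hP (.mlp k)) (hZ i) j
  exact (hY i j).add hM

end Analyticity

/-- The property concerns whole families indexed by the parameter, because analyticity is not a
condition at a single parameter. -/
theorem foldl_induction {α E : Type*} {Q : (E → α) → Prop} :
    ∀ (n : ℕ) (f : E → α → Fin n → α) (X : E → α),
      (∀ l X, Q X → Q fun y => f y (X y) l) → Q X → Q fun y => Fin.foldl n (f y) (X y) := by
  intro n
  induction n with
  | zero => intro f X _ hX; simpa using hX
  | succ n ih =>
    intro f X hf hX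
    simp only [Fin.foldl_succ]
    exact ih (fun y Z l => f y Z l.succ) (fun y => f y (X y) 0) (fun l Z hZ => hf l.succ Z hZ)
      (hf 0 X hX)

section Model

variable {V : Type*} [Fintype V] {c : Config}

theorem analyticAt_param (k : Param V c) (θ₀ : Params V c) :
    AnalyticAt ℝ (fun θ : Params V c => θ k) θ₀ :=
  (EuclideanSpace.proj k : Params V c →L[ℝ] ℝ).analyticAt θ₀

theorem analyticAt_lastRep (hact : ∀ l x, AnalyticAt ℝ (c.block l).act x)
    (hepsAttn : ∀ l, 0 < (c.block l).epsAttn) (hepsMlp : ∀ l, 0 < (c.block l).epsMlp)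
    (s : Prompt V c.K) (i : Fin c.d) (θ₀ : Params V c) :
    AnalyticAt ℝ (fun θ : Params V c => lastRep c θ s i) θ₀ := by
  have h := foldl_induction (E := Params V c)
    (Q := fun X : Params V c → Matrix (Fin (s.1.val + 1)) (Fin c.d) ℝ =>
      ∀ i j, AnalyticAt ℝ (fun θ => X θ i j) θ₀) c.L
    (fun θ Y l => blockMap (c.block l) (fun k => θ (.block l k)) Y)
    (fun θ => embed c θ s)
    (fun l X hX => analyticAt_blockMap (hact l) (hepsAttn l) (hepsMlp l)
      (fun k => analyticAt_param _ _) hX)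
    (fun i j => (analyticAt_param _ _).add (analyticAt_param _ _))
  exact h _ i

/-- The log-sum-exp form follows from `∑ v, p v = 1` and leaves a single logarithm, of a positive
sum. -/
theorem crossEntropy_softmax [Nonempty V] (z : V → ℝ) {p : V → ℝ} (hp : ∑ v, p v = 1) :
    crossEntropy (softmax z) p = Real.log (∑ v, Real.exp (z v)) - ∑ v, p v * z v := by
  have hpos : 0 < ∑ v, Real.exp (z v) :=
    Finset.sum_pos (fun v _ => Real.exp_pos _) Finset.univ_nonempty
  have h : ∀ v, Real.log (softmax z v) = z v - Real.log (∑ v, Real.exp (z v)) := fun v => by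
    rw [softmax, Real.log_div (Real.exp_pos _).ne' hpos.ne', Real.log_exp]
  simp only [crossEntropy, h, mul_sub, Finset.sum_sub_distrib, ← Finset.sum_mul, hp]
  ring

theorem analyticAt_loss [Nonempty V] (hact : ∀ l x, AnalyticAt ℝ (c.block l).act x)
    (hepsAttn : ∀ l, 0 < (c.block l).epsAttn) (hepsMlp : ∀ l, 0 < (c.block l).epsMlp)
    (hepsOut : 0 < c.epsOut) (s : Prompt V c.K) {p : V → ℝ} (hp : ∑ v, p v = 1)
    (θ₀ : Params V c) : AnalyticAt ℝ (loss c s p) θ₀ := by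
  have hz : ∀ v, AnalyticAt ℝ (fun θ : Params V c => ∑ i, θ (.unembed v i) *
      layerNorm c.epsOut (fun k => θ (.scaleOut k)) (fun k => θ (.shiftOut k))
        (lastRep c θ s) i) θ₀ := fun v =>
    Finset.analyticAt_fun_sum _ fun i _ => (analyticAt_param _ _).mul
      (analyticAt_layerNorm hepsOut (fun _ => analyticAt_param _ _)
        (fun _ => analyticAt_param _ _)
        (fun j => analyticAt_lastRep hact hepsAttn hepsMlp s j θ₀) i)
  have heq : loss c s p = fun θ => crossEntropy (predict c θ s) p := rfl
  simp only [heq, predict, crossEntropy_softmax _ hp]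
  have h1 := Finset.analyticAt_fun_sum Finset.univ fun v _ => (hz v).rexp'
  have h2 := Finset.analyticAt_fun_sum Finset.univ fun v _ =>
    (analyticAt_const (v := p v)).mul (hz v)
  exact (h1.comp_log (Finset.sum_pos (fun v _ => Real.exp_pos _) Finset.univ_nonempty)).sub h2

end Model

end TransformerLM

/-! ### Parameters for which blocks act trivially -/

namespace TransformerLM

section TrivialBlocks

/-- The last affine layer vanishes whatever it receives, so the value of `σ` at `0` does not matter.
-/
theorem mlp_zero_param (σ : ℝ → ℝ) (l : List ℕ) : ∀ {a b : ℕ} {P : MlpParam a l b → ℝ}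
    (x : Fin a → ℝ), (∀ k, P k = 0) → mlp σ a l b P x = 0 := by
  induction l with
  | nil =>
    intro a b P x hP
    ext i
    have h1 : ∀ k : (Fin b × Fin a) ⊕ Fin b, (show (Fin b × Fin a) ⊕ Fin b → ℝ from P) k = 0 := hP
    exact (congrArg₂ (· + ·) (Finset.sum_eq_zero fun j _ => by rw [h1, zero_mul])
      (h1 (Sum.inr i))).trans (add_zero 0)
  | cons c l ih =>
    intro a b P x hP
    exact ih (P := fun k => P (Sum.inr k)) _ fun k => hP (Sum.inr k)

variable {n d : ℕ} {c : BlockConfig} {P : BlockParam d c → ℝ}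

theorem blockMap_of_mlp_zero (hP : ∀ k, P (.mlp k) = 0) (X : Matrix (Fin n) (Fin d) ℝ) :
    blockMap c P X = X + multiHead
      (fun h => Matrix.of fun i j => P (.query h i j))
      (fun h => Matrix.of fun i j => P (.key h i j))
      (fun h => Matrix.of fun i j => P (.value h i j))
      (Matrix.of fun k i => P (.out k i))
      (layerNormRows c.epsAttn (fun i => P (.scaleAttn i)) (fun i => P (.shiftAttn i)) X) := by
  ext i j
  simp [blockMap, mlp_zero_param c.act c.hidden _ hP]

theorem blockMap_eq_self (hP : ∀ k, P (.mlp k) = 0) (hO : ∀ k i, P (.out k i) = 0)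
    (X : Matrix (Fin n) (Fin d) ℝ) : blockMap c P X = X := by
  rw [blockMap_of_mlp_zero hP]
  ext i j
  simp [multiHead, Matrix.mul_apply, hO]

theorem foldl_eq_self {α : Type*} : ∀ {n : ℕ} {f : α → Fin n → α} (x : α),
    (∀ y l, f y l = y) → Fin.foldl n f x = x := by
  intro n
  induction n with
  | zero => intro f x _; simp
  | succ n ih =>
    intro f x h
    rw [Fin.foldl_succ, h]
    exact ih x fun y l => h y l.succ

theorem foldl_eq_first {α : Type*} {n : ℕ} (hn : 0 < n) {f : α → Fin n → α} (x : α)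
    (h : ∀ y l, l ≠ ⟨0, hn⟩ → f y l = y) : Fin.foldl n f x = f x ⟨0, hn⟩ := by
  obtain ⟨m, rfl⟩ := Nat.exists_eq_succ_of_ne_zero hn.ne'
  rw [Fin.foldl_succ]
  exact foldl_eq_self _ fun y l => h y l.succ (Fin.succ_ne_zero l)

end TrivialBlocks

theorem lastRep_zero {V : Type*} {c : Config} (s : Prompt V c.K) (i : Fin c.d) : lastRep c (0 : Params V c) s i = 0 := by
  have h : stack c (0 : Params V c) (embed c 0 s) = embed c 0 s :=
    foldl_eq_self _ fun Y l => blockMap_eq_self (fun _ => rfl) (fun _ _ => rfl) Y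
  change stack c (0 : Params V c) (embed c 0 s) _ i = 0
  rw [h]
  simp [embed]

/-! ### The Hessian of the loss at the zero parameter -/

section Hessian

variable {V : Type*} [Fintype V]

/-- The second derivative at `0` of the cross-entropy along logits that vanish to second order. -/
theorem deriv_deriv_crossEntropy_sq_mul [Nonempty V] {y : ℝ → V → ℝ}
    (hy : ∀ v t, AnalyticAt ℝ (fun t => y t v) t) {p : V → ℝ} (hp : ∑ v, p v = 1) :
    deriv (deriv fun t : ℝ => crossEntropy (softmax fun v => t ^ 2 * y t v) p) 0 =
      2 * ∑ v, ((Fintype.card V : ℝ)⁻¹ - p v) * y 0 v := by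
  -- The logits have derivative `t * w t`, so the cross-entropy has derivative `t * k t` and its
  -- second derivative at `0` is `k 0`.
  let w : ℝ → V → ℝ := fun t v => 2 * y t v + t * deriv (fun t => y t v) t
  let S : ℝ → ℝ := fun t => ∑ v, Real.exp (t ^ 2 * y t v)
  let k : ℝ → ℝ := fun t =>
    (∑ v, Real.exp (t ^ 2 * y t v) * w t v) / S t - ∑ v, p v * w t v
  have hS : ∀ t, 0 < S t := fun t =>
    Finset.sum_pos (fun v _ => Real.exp_pos _) Finset.univ_nonempty
  have hz : ∀ v t, HasDerivAt (fun t => t ^ 2 * y t v) (t * w t v) t := fun v t => by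
    have h := (hasDerivAt_pow 2 t).mul (hy v t).differentiableAt.hasDerivAt
    refine h.congr_deriv ?_
    simp only [w]; push_cast; ring
  have hg : deriv (fun t : ℝ => crossEntropy (softmax fun v => t ^ 2 * y t v) p) =
      fun t => t * k t := by
    ext t
    simp only [crossEntropy_softmax _ hp]
    have hlog : HasDerivAt (fun t => Real.log (S t))
        ((∑ v, Real.exp (t ^ 2 * y t v) * (t * w t v)) / S t) t :=
      (HasDerivAt.fun_sum fun v _ => (hz v t).exp).log (hS t).ne'
    have hlin : HasDerivAt (fun t => ∑ v, p v * (t ^ 2 * y t v))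
        (∑ v, p v * (t * w t v)) t :=
      HasDerivAt.fun_sum fun v _ => (hz v t).const_mul (p v)
    refine (hlog.sub hlin).deriv.trans ?_
    simp only [k, mul_sub, ← mul_div_assoc, Finset.mul_sum]
    congr 1
    · congr 1
      exact Finset.sum_congr rfl fun v _ => by ring
    · exact Finset.sum_congr rfl fun v _ => by ring
  have hyd : ∀ v, DifferentiableAt ℝ (fun t => y t v) 0 := fun v => (hy v 0).differentiableAt
  have hyd' : ∀ v, DifferentiableAt ℝ (fun t => deriv (fun t => y t v) t) 0 := fun v =>
    (hy v 0).deriv.differentiableAt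
  have hwd : ∀ v, DifferentiableAt ℝ (fun t => w t v) 0 := fun v =>
    ((hyd v).const_mul 2).add (differentiableAt_id.mul (hyd' v))
  have hkd : DifferentiableAt ℝ k 0 := by
    refine ((DifferentiableAt.fun_sum fun v _ => ((hz v 0).differentiableAt.exp).mul (hwd v)).div
      (DifferentiableAt.fun_sum fun v _ => (hz v 0).differentiableAt.exp) (hS 0).ne').sub
      (DifferentiableAt.fun_sum fun v _ => (hwd v).const_mul (p v))
  rw [hg]
  refine ((hasDerivAt_id (0 : ℝ)).mul hkd.hasDerivAt).deriv.trans ?_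
  simp [k, S, w, sub_mul, Finset.sum_div, Finset.sum_sub_distrib]
  rw [mul_sub, Finset.mul_sum, Finset.mul_sum]
  congr 1
  · exact Finset.sum_congr rfl fun v _ => by ring
  · exact Finset.sum_congr rfl fun v _ => by ring

/-- Expanding the square leaves `∑ v, p v ^ 2` minus the inverse cardinality, and `p v ^ 2 ≤ p v`.
-/
theorem sum_sub_inv_card_sq_le_one [Nonempty V] {p : V → ℝ} (hp : p ∈ stdSimplex ℝ V) :
    ∑ v, ((Fintype.card V : ℝ)⁻¹ - p v) ^ 2 ≤ 1 := by
  have hN : (Fintype.card V : ℝ) ≠ 0 := by simp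
  have h1 : ∑ v, p v ^ 2 ≤ 1 := by
    rw [← hp.2]
    refine Finset.sum_le_sum fun v _ => ?_
    have : p v ≤ 1 := hp.2 ▸ Finset.single_le_sum (fun v _ => hp.1 v) (Finset.mem_univ v)
    nlinarith [hp.1 v]
  have h2 : ∑ v, ((Fintype.card V : ℝ)⁻¹ - p v) ^ 2 =
      ∑ v, p v ^ 2 - (Fintype.card V : ℝ)⁻¹ := by
    have : ∀ v, ((Fintype.card V : ℝ)⁻¹ - p v) ^ 2 = (Fintype.card V : ℝ)⁻¹ ^ 2 -
        2 * (Fintype.card V : ℝ)⁻¹ * p v + p v ^ 2 := fun v => by ring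
    simp only [this, Finset.sum_add_distrib, Finset.sum_sub_distrib, ← Finset.mul_sum, hp.2]
    simp only [Finset.sum_const, Finset.card_univ, nsmul_eq_mul]
    field_simp
    ring
  rw [h2]
  have : 0 ≤ (Fintype.card V : ℝ)⁻¹ := by positivity
  linarith

/-- Coordinatewise in `i`, use `2ab ≤ a² + b²`, then Cauchy-Schwarz over `v`. -/
theorem two_mul_sum_mul_sum_le {κ : Type*} [Fintype κ] {w : V → ℝ} (hw : ∑ v, w v ^ 2 ≤ 1)
    (U : V → κ → ℝ) (β : κ → ℝ) :
    2 * ∑ v, w v * ∑ i, U v i * β i ≤ (∑ v, ∑ i, U v i ^ 2) + ∑ i, β i ^ 2 := by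
  have h1 : ∑ v, w v * ∑ i, U v i * β i = ∑ i, (∑ v, w v * U v i) * β i := by
    simp only [Finset.mul_sum, Finset.sum_mul]
    rw [Finset.sum_comm]
    exact Finset.sum_congr rfl fun i _ => Finset.sum_congr rfl fun v _ => by ring
  rw [h1, Finset.sum_comm, ← Finset.sum_add_distrib, Finset.mul_sum]
  refine Finset.sum_le_sum fun i _ => ?_
  have hcs := Finset.sum_mul_sq_le_sq_mul_sq Finset.univ w (fun v => U v i)
  have hU : 0 ≤ ∑ v, U v i ^ 2 := Finset.sum_nonneg fun v _ => sq_nonneg _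
  nlinarith [sq_nonneg ((∑ v, w v * U v i) - β i)]

variable {c : Config}

theorem sum_unembed_add_shiftOut_le_norm_sq (θ : Params V c) :
    (∑ v, ∑ i, θ (.unembed v i) ^ 2) + ∑ i, θ (.shiftOut i) ^ 2 ≤ ‖θ‖ ^ 2 := by
  classical
  let g : (V × Fin c.d) ⊕ Fin c.d ↪ Param V c :=
    ⟨Sum.elim (fun q => .unembed q.1 q.2) .shiftOut, by
      rintro (⟨v, i⟩ | i) (⟨v', i'⟩ | i') h <;> simp_all⟩
  have h : ∑ k, θ (g k) ^ 2 = (∑ v, ∑ i, θ (.unembed v i) ^ 2) + ∑ i, θ (.shiftOut i) ^ 2 := by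
    rw [Fintype.sum_sum_type, Fintype.sum_prod_type]
    rfl
  rw [← h, EuclideanSpace.real_norm_sq_eq, ← Finset.sum_map Finset.univ g fun k => θ k ^ 2]
  exact Finset.sum_le_sum_of_subset_of_nonneg (Finset.subset_univ _) fun _ _ _ => sq_nonneg _

theorem layerNorm_smul {d : ℕ} (ε t : ℝ) (γ β x : Fin d → ℝ) (i : Fin d) :
    layerNorm ε (fun k => t * γ k) (fun k => t * β k) x i = t * layerNorm ε γ β x i := by
  simp only [layerNorm]; ring

theorem layerNorm_zero {d : ℕ} (ε : ℝ) (γ β : Fin d → ℝ) {x : Fin d → ℝ} (hx : ∀ i, x i = 0)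
    (i : Fin d) : layerNorm ε γ β x i = β i := by
  simp [layerNorm, mean, hx]

/-- The Hessian of the loss at the zero parameters is at most the identity. -/
theorem deriv_deriv_loss_zero_le [Nonempty V] (hact : ∀ l x, AnalyticAt ℝ (c.block l).act x)
    (hepsAttn : ∀ l, 0 < (c.block l).epsAttn) (hepsMlp : ∀ l, 0 < (c.block l).epsMlp)
    (hepsOut : 0 < c.epsOut) (s : Prompt V c.K) {p : V → ℝ} (hp : p ∈ stdSimplex ℝ V)
    (θ : Params V c) :
    deriv (deriv fun t : ℝ => loss c s p (0 + t • θ)) 0 ≤ ‖θ‖ ^ 2 := by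
  let y : ℝ → V → ℝ := fun t v => ∑ i, θ (.unembed v i) *
    layerNorm c.epsOut (fun k => θ (.scaleOut k)) (fun k => θ (.shiftOut k))
      (lastRep c (t • θ) s) i
  -- One factor `t` comes from the unembedding matrix, the other from the scale and shift of the
  -- last normalization.
  have hloss : (fun t : ℝ => loss c s p (0 + t • θ)) =
      fun t => crossEntropy (softmax fun v => t ^ 2 * y t v) p := by
    ext t
    rw [zero_add, loss, predict]
    congr 2
    ext v
    simp only [PiLp.smul_apply, smul_eq_mul, layerNorm_smul, y, Finset.mul_sum]
    exact Finset.sum_congr rfl fun i _ => by ring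
  have hy : ∀ v t, AnalyticAt ℝ (fun t => y t v) t := fun v t =>
    Finset.analyticAt_fun_sum _ fun i _ => analyticAt_const.mul
      (analyticAt_layerNorm hepsOut (fun _ => analyticAt_const) (fun _ => analyticAt_const)
        (fun j => (analyticAt_lastRep hact hepsAttn hepsMlp s j _).comp
          (f := fun t : ℝ => t • θ) (analyticAt_id.smul analyticAt_const)) i)
  -- At the zero parameter the representation is `0`, which the last normalization sends to its
  -- shift.
  have hy0 : ∀ v, y 0 v = ∑ i, θ (.unembed v i) * θ (.shiftOut i) := fun v => by
    refine Finset.sum_congr rfl fun i _ => ?_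
    rw [zero_smul, layerNorm_zero _ _ _ fun j => lastRep_zero s j]
  rw [hloss, deriv_deriv_crossEntropy_sq_mul hy hp.2]
  simp only [hy0]
  exact (two_mul_sum_mul_sum_le (sum_sub_inv_card_sq_le_one hp) _ _).trans
    (sum_unembed_add_shiftOut_le_norm_sq θ)

end Hessian

end TransformerLM

/-! ### A block that averages over the prompt -/

namespace TransformerLM

section UniformAttention

/-- Zero queries and keys give equal scores, and the last position sees the entire prompt, hence the
uniform average. -/
theorem causalAttention_zero_last {m d a : ℕ} (W : Matrix (Fin d) (Fin a) ℝ)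
    (X : Matrix (Fin (m + 1)) (Fin d) ℝ) (j : Fin a) :
    causalAttention 0 0 W X (Fin.last m) j = (∑ k, (X * W) k j) / (m + 1) := by
  rw [causalAttention, Matrix.mul_apply, Finset.sum_div]
  refine Finset.sum_congr rfl fun k _ => ?_
  simp [rowNormalize, causalMask, Fin.le_last, div_eq_inv_mul]

variable {V : Type*} {c : Config}

/-- Parameters for which every block but the block `l₀` is the identity, and the block `l₀` adds
to the first coordinate of the representation `o` times the uniform average of the first
coordinates of the normalized rows. -/
def averagingParams (V : Type*) (c : Config) (l₀ : Fin c.L) (o : ℝ) (tok : V → Fin c.d → ℝ)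
    (pos : Fin c.K → Fin c.d → ℝ) : Params V c :=
  WithLp.toLp 2 fun k => match k with
    | .token v i => tok v i
    | .position j i => pos j i
    | .block _ (.scaleAttn _) => 1
    | .block _ (.value _ i _) => if i.val = 0 then 1 else 0
    | .block l (.out k i) =>
      if l = l₀ ∧ k.1.val = 0 ∧ k.2.val = 0 ∧ i.val = 0 then o else 0
    | _ => 0

theorem embed_averagingParams (l₀ : Fin c.L) (o : ℝ) (tok : V → Fin c.d → ℝ)
    (pos : Fin c.K → Fin c.d → ℝ) (s : Prompt V c.K) (j : Fin (s.1.val + 1)) :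
    embed c (averagingParams V c l₀ o tok pos) s j =
      tok (s.2 j) + pos (Fin.castLE s.1.isLt j) := rfl

theorem lastRep_averagingParams (hL : 0 < c.L) (hd : 0 < c.d)
    (hheads : 1 ≤ (c.block ⟨0, hL⟩).heads) (hattn : 1 ≤ (c.block ⟨0, hL⟩).attnDim) (o : ℝ)
    (tok : V → Fin c.d → ℝ) (pos : Fin c.K → Fin c.d → ℝ) (s : Prompt V c.K) :
    lastRep c (averagingParams V c ⟨0, hL⟩ o tok pos) s ⟨0, hd⟩ =
      (tok (s.2 (Fin.last _)) ⟨0, hd⟩ + pos (Fin.castLE s.1.isLt (Fin.last _)) ⟨0, hd⟩) +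
        (∑ j, layerNorm (c.block ⟨0, hL⟩).epsAttn (fun _ => 1) (fun _ => 0)
          (tok (s.2 j) + pos (Fin.castLE s.1.isLt j)) ⟨0, hd⟩) / (s.1.val + 1) * o := by
  let l₀ : Fin c.L := ⟨0, hL⟩
  let θ := averagingParams V c l₀ o tok pos
  have hstack : stack c θ (embed c θ s) =
      blockMap (c.block l₀) (fun k => θ (.block l₀ k)) (embed c θ s) :=
    foldl_eq_first hL _ fun Y l hl => blockMap_eq_self (fun _ => rfl)
      (fun k i => if_neg fun h => hl h.1) Y
  change stack c θ (embed c θ s) (Fin.last _) ⟨0, hd⟩ = _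
  rw [hstack, blockMap_of_mlp_zero (fun _ => rfl)]
  change embed c θ s (Fin.last _) ⟨0, hd⟩ + _ = _
  rw [embed_averagingParams, Pi.add_apply]
  congr 1
  have h0 : ∀ k : Fin (c.block l₀).heads × Fin (c.block l₀).attnDim,
      k ≠ (⟨0, hheads⟩, ⟨0, hattn⟩) → θ (.block l₀ (.out k ⟨0, hd⟩)) = 0 := fun k hk =>
    if_neg fun h => hk (Prod.ext (Fin.ext h.2.1) (Fin.ext h.2.2.1))
  have h1 : θ (.block l₀ (.out (⟨0, hheads⟩, ⟨0, hattn⟩) ⟨0, hd⟩)) = o := by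
    simp [θ, averagingParams]
  have hval : ∀ i, θ (.block l₀ (.value ⟨0, hheads⟩ i ⟨0, hattn⟩)) =
      if i.val = 0 then 1 else 0 := fun _ => rfl
  rw [multiHead, Matrix.mul_apply, Finset.sum_eq_single (⟨0, hheads⟩, ⟨0, hattn⟩)
    (fun k _ hk => by simp only [Matrix.of_apply]; rw [h0 k hk, mul_zero])
    (fun h => absurd (Finset.mem_univ _) h)]
  simp only [Matrix.of_apply]
  rw [h1]
  congr 1
  refine (causalAttention_zero_last _ _ _).trans ?_
  congr 1
  refine Finset.sum_congr rfl fun k _ => ?_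
  rw [Matrix.mul_apply, Finset.sum_eq_single ⟨0, hd⟩]
  · simp only [Matrix.of_apply]
    rw [hval, if_pos rfl, mul_one]
    rfl
  · intro i _ hi
    simp only [Matrix.of_apply]
    rw [hval, if_neg fun h => hi (Fin.ext h), mul_zero]
  · exact fun h => absurd (Finset.mem_univ _) h

end UniformAttention

/-! ### Separating two prompts -/

section Separation

/-- The vector `(p, -p, q, -q, 0, …, 0)`. -/
def balancedVec (d : ℕ) (p q : ℝ) : Fin d → ℝ := fun i =>
  if i.val = 0 then p else if i.val = 1 then -p else if i.val = 2 then q else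
    if i.val = 3 then -q else 0

theorem balancedVec_add (d : ℕ) (p q p' q' : ℝ) :
    balancedVec d p q + balancedVec d p' q' = balancedVec d (p + p') (q + q') := by
  ext i
  simp only [balancedVec, Pi.add_apply]
  split_ifs <;> ring

theorem sum_comp_balancedVec {d : ℕ} (hd : 4 ≤ d) (p q : ℝ) {φ : ℝ → ℝ} (hφ : φ 0 = 0) :
    ∑ i, φ (balancedVec d p q i) = φ p + φ (-p) + φ q + φ (-q) := by
  have h := Fin.sum_univ_eq_sum_range (fun k => φ (if k = 0 then p else if k = 1 then -p else
    if k = 2 then q else if k = 3 then -q else 0)) d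
  refine h.trans ?_
  rw [← Finset.sum_subset (Finset.range_subset_range.2 hd)]
  · simp [Finset.sum_range_succ]
  · intro k _ hk
    have hk : 4 ≤ k := by simpa using hk
    rw [if_neg (by omega), if_neg (by omega), if_neg (by omega), if_neg (by omega), hφ]

/-- The mean is zero, so `q` affects the first coordinate only through the variance. Two opposite
pairs require four coordinates. -/
theorem layerNorm_balancedVec {d : ℕ} (hd : 4 ≤ d) (ε p q : ℝ) (i : Fin d) :
    layerNorm ε (fun _ => 1) (fun _ => 0) (balancedVec d p q) i =
      balancedVec d p q i / Real.sqrt ((2 * p ^ 2 + 2 * q ^ 2) / d + ε) := by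
  have hm : mean (balancedVec d p q) = 0 := by
    have := sum_comp_balancedVec hd p q (φ := id) rfl
    simp only [id] at this
    rw [mean, this]; ring
  have hv : variance (balancedVec d p q) = (2 * p ^ 2 + 2 * q ^ 2) / d := by
    have := sum_comp_balancedVec hd p q (φ := fun x => x ^ 2) (by norm_num)
    simp only [variance, hm, sub_zero, this]; ring
  simp only [layerNorm, hm, hv]; ring

/-- Distinct prompts are separated by some choice of the parameters. -/
theorem exists_lastRep_ne {V : Type*} {c : Config} (hd : 4 ≤ c.d) (hL : 1 ≤ c.L)
    (hheads : ∀ l, 1 ≤ (c.block l).heads) (hattn : ∀ l, 1 ≤ (c.block l).attnDim)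
    (hepsAttn : ∀ l, 0 < (c.block l).epsAttn) {u v : Prompt V c.K} (huv : u ≠ v) :
    ∃ (θ : Params V c) (i : Fin c.d), lastRep c θ u i ≠ lastRep c θ v i := by
  classical
  have hd0 : 0 < c.d := by omega
  obtain ⟨m, s⟩ := u
  obtain ⟨m', s'⟩ := v
  have key := fun o tok pos =>
    lastRep_averagingParams (V := V) hL hd0 (hheads _) (hattn _) o tok pos
  by_cases hm : m = m'
  swap
  -- Different lengths: with attention switched off by `o = 0`, the position embedding of the last
  -- token tells them apart.
  · refine ⟨averagingParams V c ⟨0, hL⟩ 0 0 fun j _ => if j = m then 1 else 0, ⟨0, hd0⟩, ?_⟩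
    rw [key, key]
    have h1 : Fin.castLE m.isLt (Fin.last m.val) = m := rfl
    have h2 : Fin.castLE m'.isLt (Fin.last m'.val) = m' := rfl
    simp [h1, h2, Ne.symm hm]
  subst hm
  by_cases hlast : s (Fin.last _) = s' (Fin.last _)
  swap
  · refine ⟨averagingParams V c ⟨0, hL⟩ 0 (fun w _ => if w = s (Fin.last _) then 1 else 0) 0,
      ⟨0, hd0⟩, ?_⟩
    rw [key, key]
    simp [Ne.symm hlast]
  obtain ⟨i, hi⟩ : ∃ i, s i ≠ s' i := by
    by_contra h
    push Not at h
    exact huv (by rw [funext h])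
  by_contra hno
  push Not at hno
  -- The hard case has equal lengths and equal last tokens. The token `s i` is marked by `p = 1` and
  -- the position `i` by `q = M`; `κ q` is the normalized first coordinate of a marked token.
  let κ : ℝ → ℝ := fun q =>
    1 / Real.sqrt ((2 * 1 ^ 2 + 2 * q ^ 2) / c.d + (c.block ⟨0, hL⟩).epsAttn)
  let tok : V → Fin c.d → ℝ := fun w => balancedVec c.d (if w = s i then 1 else 0) 0
  let pos : ℝ → Fin c.K → Fin c.d → ℝ := fun M j =>
    balancedVec c.d 0 (if j = Fin.castLE m.isLt i then M else 0)
  have hN : ∀ (M : ℝ) (t : Fin (m.val + 1) → V) (j : Fin (m.val + 1)),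
      layerNorm (c.block ⟨0, hL⟩).epsAttn (fun _ => 1) (fun _ => 0)
        (tok (t j) + pos M (Fin.castLE m.isLt j)) ⟨0, hd0⟩ =
      if t j = s i then κ (if j = i then M else 0) else 0 := by
    intro M t j
    simp only [tok, pos, balancedVec_add, add_zero, zero_add, layerNorm_balancedVec hd,
      (Fin.castLE_injective m.isLt).eq_iff]
    by_cases h : t j = s i <;> simp [h, balancedVec, κ]
  have hsum : ∀ M : ℝ, ∑ j, (if s j = s i then κ (if j = i then M else 0) else 0) =
      ∑ j, (if s' j = s i then κ (if j = i then M else 0) else 0) := by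
    intro M
    have h := hno (averagingParams V c ⟨0, hL⟩ 1 tok (pos M)) ⟨0, hd0⟩
    rw [key, key] at h
    simp only [hN, hlast, mul_one] at h
    have hpos : (m.val : ℝ) + 1 ≠ 0 := by positivity
    exact (div_left_inj' hpos).1 (add_left_cancel h)
  -- Passing from `M = 0` to `M = 1` changes only the term at position `i`, so the difference
  -- detects whether the token there is `s i`.
  have hdiff : ∀ t : Fin (m.val + 1) → V,
      ∑ j, (if t j = s i then κ (if j = i then 1 else 0) else 0) -
        ∑ j, (if t j = s i then κ (if j = i then 0 else 0) else 0) =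
      if t i = s i then κ 1 - κ 0 else 0 := by
    intro t
    rw [← Finset.sum_sub_distrib, Finset.sum_eq_single i]
    · by_cases h : t i = s i <;> simp [h]
    · intro j _ hj
      simp [hj]
    · exact fun h => absurd (Finset.mem_univ _) h
  have h1 := hdiff s
  have h2 := hdiff s'
  rw [hsum 1, hsum 0, h2, if_pos rfl, if_neg (Ne.symm hi)] at h1
  have hε := hepsAttn ⟨0, hL⟩
  have hcd : (0 : ℝ) < c.d := by exact_mod_cast hd0
  have hlt : κ 1 < κ 0 := by
    refine one_div_lt_one_div_of_lt (Real.sqrt_pos.2 (by positivity))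
      (Real.sqrt_lt_sqrt (by positivity) ?_)
    gcongr
    norm_num
  linarith

end Separation

/-! ### Almost sure injectivity and its preservation by training -/

section Training

variable {V : Type*} [Fintype V] {c : Config}

theorem ae_injective_lastRep (hd : 4 ≤ c.d) (hL : 1 ≤ c.L)
    (hheads : ∀ l, 1 ≤ (c.block l).heads) (hattn : ∀ l, 1 ≤ (c.block l).attnDim)
    (hact : ∀ l x, AnalyticAt ℝ (c.block l).act x)
    (hepsAttn : ∀ l, 0 < (c.block l).epsAttn) (hepsMlp : ∀ l, 0 < (c.block l).epsMlp) :
    ∀ᵐ θ : Params V c, Function.Injective fun u : Prompt V c.K => lastRep c θ u := by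
  have h : ∀ q : Prompt V c.K × Prompt V c.K, ∀ᵐ θ : Params V c,
      lastRep c θ q.1 = lastRep c θ q.2 → q.1 = q.2 := by
    rintro ⟨u, v⟩
    by_cases huv : u = v
    · exact Filter.Eventually.of_forall fun _ _ => huv
    obtain ⟨θ₀, i, hi⟩ := exists_lastRep_ne hd hL hheads hattn hepsAttn huv
    have han : AnalyticOnNhd ℝ (fun θ : Params V c => lastRep c θ u i - lastRep c θ v i)
        Set.univ := fun θ _ => (analyticAt_lastRep hact hepsAttn hepsMlp u i θ).sub
      (analyticAt_lastRep hact hepsAttn hepsMlp v i θ)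
    filter_upwards [han.ae_ne_zero volume (sub_ne_zero.2 hi)] with θ hθ heq
    exact absurd (by rw [heq, sub_self]) hθ
  filter_upwards [ae_all_iff.2 h] with θ hθ u v huv using hθ (u, v) huv

theorem volume_preimage_gdStep [Nonempty V] (hact : ∀ l x, AnalyticAt ℝ (c.block l).act x)
    (hepsAttn : ∀ l, 0 < (c.block l).epsAttn) (hepsMlp : ∀ l, 0 < (c.block l).epsMlp)
    (hepsOut : 0 < c.epsOut) (s : Prompt V c.K) {p : V → ℝ} (hp : p ∈ stdSimplex ℝ V) {η : ℝ}
    (hη : η ∈ Set.Ioo (0 : ℝ) 1) {N : Set (Params V c)} (hN : volume N = 0) :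
    volume (gdStep c η s p ⁻¹' N) = 0 := by
  have hloss : AnalyticOnNhd ℝ (loss c s p) Set.univ := fun θ _ =>
    analyticAt_loss hact hepsAttn hepsMlp hepsOut s hp.2 θ
  have hstep : AnalyticOnNhd ℝ (gdStep c η s p) Set.univ := fun θ hθ =>
    analyticAt_id.sub (AnalyticAt.smul (f := fun _ => η) analyticAt_const (hloss.gradient θ hθ))
  exact hstep.measure_preimage_eq_zero volume (x₀ := 0) (fun v hv =>
    fderiv_sub_smul_gradient_injective hloss hη
      (deriv_deriv_loss_zero_le hact hepsAttn hepsMlp hepsOut s hp) hv) hN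

end Training

end TransformerLM

theorem theorem2p3 {V : Type*} [Fintype V] (c : TransformerLM.Config)
    (hd : 4 ≤ c.d) (hL : 1 ≤ c.L)
    (hheads : ∀ l, 1 ≤ (c.block l).heads) (hattn : ∀ l, 1 ≤ (c.block l).attnDim)
    (hact : ∀ l x, AnalyticAt ℝ (c.block l).act x)
    (hepsAttn : ∀ l, 0 < (c.block l).epsAttn) (hepsMlp : ∀ l, 0 < (c.block l).epsMlp)
    (hepsOut : 0 < c.epsOut)
    (T : ℕ) (s : Fin T → TransformerLM.Prompt V c.K)
    (p : Fin T → V → ℝ) (hp : ∀ t, p t ∈ stdSimplex ℝ V)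
    (η : Fin T → ℝ) (hη : ∀ t, η t ∈ Set.Ioo (0 : ℝ) 1)
    (μ : Measure (TransformerLM.Params V c)) (hμ : μ ≪ volume)
    {Ω : Type*} [MeasurableSpace Ω] (P : Measure Ω) [IsProbabilityMeasure P]
    (θ : Fin (T + 1) → Ω → TransformerLM.Params V c)
    (hinit : ProbabilityTheory.HasLaw (θ 0) μ P)
    (hgd : ∀ (t : Fin T) (ω : Ω),
      θ t.succ ω = TransformerLM.gdStep c (η t) (s t) (p t) (θ t.castSucc ω)) :
    (∀ᵐ ω ∂P, Function.Injective fun u : TransformerLM.Prompt V c.K =>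
      TransformerLM.lastRep c (θ (Fin.last T) ω) u) ∧
    P {ω | ∃ u v : TransformerLM.Prompt V c.K, u ≠ v ∧
      TransformerLM.lastRep c (θ (Fin.last T) ω) u =
        TransformerLM.lastRep c (θ (Fin.last T) ω) v} = 0 := by
  -- This is absolute continuity of the law of `θ t`, stated through preimages of arbitrary null
  -- sets so that no measurability of the later iterates is needed.
  have hnull : ∀ (t : Fin (T + 1)) (N : Set (TransformerLM.Params V c)), volume N = 0 →
      P (θ t ⁻¹' N) = 0 := by
    intro t
    induction t using Fin.induction with
    | zero =>
      intro N hN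
      have hN' : P.map (θ 0) N = 0 := by rw [hinit.map_eq]; exact hμ hN
      have hae : ∀ᵐ x ∂P.map (θ 0), x ∉ N := measure_eq_zero_iff_ae_notMem.1 hN'
      exact measure_eq_zero_iff_ae_notMem.2 (ae_of_ae_map hinit.aemeasurable hae)
    | succ t ih =>
      intro N hN
      -- A training prompt has at least one token; for `T = 0` the vocabulary may be empty.
      have : Nonempty V := ⟨(s t).2 0⟩
      have h := ih _ (TransformerLM.volume_preimage_gdStep hact hepsAttn hepsMlp hepsOut (s t)
        (hp t) (hη t) hN)
      convert h using 2
      ext ω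
      simp [hgd]
  have hinj : ∀ᵐ ω ∂P, Function.Injective fun u : TransformerLM.Prompt V c.K =>
      TransformerLM.lastRep c (θ (Fin.last T) ω) u :=
    hnull (Fin.last T) _ (ae_iff.1 (TransformerLM.ae_injective_lastRep hd hL hheads hattn hact
      hepsAttn hepsMlp))
  refine ⟨hinj, ?_⟩
  rw [ae_iff] at hinj
  refine measure_mono_null ?_ hinj
  rintro ω ⟨u, v, huv, heq⟩ h
  exact huv (h heq)
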